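/- Let $\theta\in\mathbb R$ be a scalar parameter and let $\hat\theta_1\sim N(\theta,s_1^2)$ and $\hat\theta_2\sim N(\theta+b_2,s_2^2)$ be two estimators (with arbitrary joint distribution), where $s_1>0$, $s_2\ge 0$ and $b_2\in\mathbb R$; for $s_2=0$ the law of $\hat\theta_2$ is the point mass at $\theta+b_2$. Suppose that $\mathrm{MSE}(\hat\theta_2)\le \mathrm{MSE}(\hat\theta_1)$, where $\mathrm{MSE}(\hat\theta)=E[(\hat\theta-\theta)^2]$; that is, $b_2^2+s_2^2\le s_1^2$. For $0<\alpha<1$ let $z_{1-\alpha/2}$ be the $(1-\alpha/2)$-quantile of the standard normal distribution and consider the confidence intervals $$\mathrm{CI}_1=\hat\theta_1\pm z_{1-\alpha/2}\,s_1,\qquad \mathrm{CI}_2=\hat\theta_2\pm z_{1-\alpha/2}\,s_1 .$$ The coverage probability of an interval is the probability that it contains $\theta$. Then: 1. The coverage probability of $\mathrm{CI}_1$ equals $1-\alpha$, for every $\alpha\in(0,1)$. 2. If $1-\alpha\ge 0.917$ and $b_2\neq 0$, the coverage probability of $\mathrm{CI}_2$ is strictly above $1-\alpha$. 3. If $1-\alpha=0.9$,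 then for any $b_2$ the coverage probability of $\mathrm{CI}_2$ is at least $90.00\%$ after rounding to two decimals of a percent, i.e. at least $0.89995$. 4. If $1-\alpha=0.9$, the coverage probability of $\mathrm{CI}_2$ increases to $100\%$ as $|b_2|\to s_1$, in the following sense. (a) For each $s_1>0$ and $\varepsilon>0$ there is $\delta>0$, not depending on anything else, such that the coverage probability exceeds $1-\varepsilon$ whenever $|b_2|>s_1-\delta$ (and $\mathrm{MSE}(\hat\theta_2)\le \mathrm{MSE}(\hat\theta_1)$). (b) For each $s_1>0$ there is $b_0<s_1$ such that, whenever $b_0\le|b_2|<|b_2'|$, the coverage probability under $(b_2,s_2)$ with equal MSE, $b_2^2+s_2^2=s_1^2$, is strictly smaller than the coverage probability under any $(b_2',s_2')$ with $b_2'^2+s_2'^2\le s_1^2$. -/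

import Mathlib

open MeasureTheory ProbabilityTheory

noncomputable section

/-- The `p`-quantile of the standard normal distribution, `z_p = inf {x | p ≤ Φ(x)}`. -/
def stdNormalQuantile (p : ℝ) : ℝ :=
  sInf {x : ℝ | p ≤ cdf (gaussianReal 0 1) x}

/-- The mean squared error `E[(est - θ)²]` of an estimator of the scalar parameter `θ`. -/
def MSE {Ω : Type*} [MeasurableSpace Ω] (P : Measure Ω) (est : Ω → ℝ) (θ : ℝ) : ℝ :=
  ∫ ω, (est ω - θ) ^ 2 ∂P

/-- The two-sided interval `est ± z_{1-α/2} s`, as a random set. -/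
def normalCI {Ω : Type*} (est : Ω → ℝ) (s α : ℝ) (ω : Ω) : Set ℝ :=
  Set.Icc (est ω - stdNormalQuantile (1 - α / 2) * s) (est ω + stdNormalQuantile (1 - α / 2) * s)

/-- The probability that the random set `CI` contains the parameter `θ`. -/
def coverageProb {Ω : Type*} [MeasurableSpace Ω] (P : Measure Ω) (CI : Ω → Set ℝ) (θ : ℝ) : ℝ :=
  P.real {ω | θ ∈ CI ω}

/-- The sampling distributions: `est₁ ~ N(θ, s₁²)` is unbiased and `est₂ ~ N(θ + b₂, s₂²)` has
bias `b₂`. No assumption is made on the joint law. The case `s₂ = 0` is the point mass. -/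
structure NormalEstimators {Ω : Type*} [MeasurableSpace Ω] (P : Measure Ω)
    (est₁ est₂ : Ω → ℝ) (θ b₂ s₁ s₂ : ℝ) : Prop where
  s₁_pos : 0 < s₁
  s₂_nonneg : 0 ≤ s₂
  law₁ : HasLaw est₁ (gaussianReal θ (Real.toNNReal (s₁ ^ 2))) P
  law₂ : HasLaw est₂ (gaussianReal (θ + b₂) (Real.toNNReal (s₂ ^ 2))) P

end

/- With mean squared error at most `s₁²`, a bias `b` forces the standard deviation to be at most
`√(s₁² - b²)`, and for a given bias the coverage decreases in the standard deviation; so the worst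
case is the boundary `b = s₁ tanh r`, standard deviation `s₁ / cosh r`, where the coverage is
`Φ (z cosh r - sinh r) + Φ (z cosh r + sinh r) - 1`. Its derivative in `r` has the sign of
`z sinh r cosh w - cosh r sinh w` with `w = z sinh r cosh r`. This is positive as soon as
`tanh r ≥ 1 / z`; for smaller `r` the power series in `w` shows that it is positive whenever
`z² ≥ 3`, which covers the levels of at least `91.7%`. At the level `90%` the coverage dips for
small `r`, and integrating a polynomial bound of the derivative shows that it loses at most
`0.00005`. Near `|b| = s₁` the standard deviation is small, and Chebyshev's inequality applies. -/

open Set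

local notation "Φ" => cdf (gaussianReal 0 1)
local notation "z[" α "]" => stdNormalQuantile (1 - α / 2)

lemma measureReal_Icc_eq_cdf_sub {ν : Measure ℝ} [IsProbabilityMeasure ν] [NullSingletonClass ν]
    {a b : ℝ} (hab : a ≤ b) : ν.real (Icc a b) = cdf ν b - cdf ν a := by
  rw [measureReal_congr Ioc_ae_eq_Icc.symm, ← Iic_sdiff_Iic,
    measureReal_sdiff (Iic_subset_Iic.2 hab) measurableSet_Iic, ← cdf_eq_real, ← cdf_eq_real]

lemma continuous_gaussianPDFReal (μ : ℝ) (v : NNReal) : Continuous (gaussianPDFReal μ v) := by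
  rw [gaussianPDFReal_def]
  fun_prop

lemma gaussianPDFReal_zero_one (x : ℝ) :
    gaussianPDFReal 0 1 x = (√(2 * Real.pi))⁻¹ * Real.exp (-x ^ 2 / 2) := by
  simp [gaussianPDFReal]

section cdf

variable {μ : ℝ} {v : NNReal}

lemma hasDerivAt_cdf_gaussianReal (hv : v ≠ 0) (x : ℝ) :
    HasDerivAt (cdf (gaussianReal μ v)) (gaussianPDFReal μ v x) x := by
  have hcont := continuous_gaussianPDFReal μ v
  have hint := integrable_gaussianPDFReal μ v
  have hcdf (y : ℝ) : cdf (gaussianReal μ v) y = ∫ t in Iic y, gaussianPDFReal μ v t := by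
    rw [cdf_eq_real, measureReal_def, gaussianReal_apply_eq_integral _ hv,
      ENNReal.toReal_ofReal (integral_nonneg (gaussianPDFReal_nonneg μ v))]
  have hftc (y : ℝ) : cdf (gaussianReal μ v) y =
      cdf (gaussianReal μ v) 0 + ∫ t in (0)..y, gaussianPDFReal μ v t := by
    rw [hcdf, hcdf, ← intervalIntegral.integral_Iic_sub_Iic hint.integrableOn hint.integrableOn]
    ring
  rw [funext hftc]
  exact (hcont.integral_hasStrictDerivAt 0 x).hasDerivAt.const_add _

lemma continuous_cdf_gaussianReal (hv : v ≠ 0) : Continuous (cdf (gaussianReal μ v)) :=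
  continuous_iff_continuousAt.2 fun x => (hasDerivAt_cdf_gaussianReal hv x).continuousAt

lemma strictMono_cdf_gaussianReal (hv : v ≠ 0) : StrictMono (cdf (gaussianReal μ v)) :=
  strictMono_of_hasDerivAt_pos (hasDerivAt_cdf_gaussianReal hv)
    fun x => gaussianPDFReal_pos μ v x hv

lemma cdf_gaussianReal_lt_one (hv : v ≠ 0) (x : ℝ) : cdf (gaussianReal μ v) x < 1 :=
  (strictMono_cdf_gaussianReal hv (lt_add_one x)).trans_le (cdf_le_one _ _)

lemma cdf_gaussianReal_neg (hv : v ≠ 0) (x : ℝ) :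
    cdf (gaussianReal 0 v) (-x) = 1 - cdf (gaussianReal 0 v) x := by
  have := nullSingletonClass_gaussianReal (μ := 0) hv
  have hmap := gaussianReal_map_neg (μ := 0) (v := v)
  rw [neg_zero] at hmap
  rw [cdf_eq_real, ← hmap, map_measureReal_apply measurable_neg measurableSet_Iic, neg_preimage,
    neg_Iic, neg_neg, hmap, measureReal_congr Ioi_ae_eq_Ici.symm, ← compl_Iic,
    probReal_compl_eq_one_sub measurableSet_Iic, ← cdf_eq_real]

end cdf

lemma cdf_stdNormalQuantile {p : ℝ} (h0 : 0 < p) (h1 : p < 1) : Φ (stdNormalQuantile p) = p := by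
  obtain ⟨x, rfl⟩ : p ∈ range Φ :=
    mem_range_of_exists_le_of_exists_ge (continuous_cdf_gaussianReal one_ne_zero)
      ((tendsto_cdf_atBot _).eventually_le_const h0).exists
      ((tendsto_cdf_atTop _).eventually_const_le h1).exists
  have hset : {y | Φ x ≤ Φ y} = Ici x :=
    Set.ext fun _ => (strictMono_cdf_gaussianReal one_ne_zero).le_iff_le
  rw [stdNormalQuantile, hset, csInf_Ici]

lemma lt_stdNormalQuantile {p x : ℝ} (hx : Φ x < p) (hp : p < 1) : x < stdNormalQuantile p := by
  rw [← (strictMono_cdf_gaussianReal one_ne_zero).lt_iff_lt,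
    cdf_stdNormalQuantile ((cdf_nonneg _ x).trans_lt hx) hp]
  exact hx

lemma cdf_gaussianReal_zero {v : NNReal} (hv : v ≠ 0) : cdf (gaussianReal 0 v) 0 = 1 / 2 := by
  have h := cdf_gaussianReal_neg hv 0
  rw [neg_zero] at h
  linarith

lemma exp_le_sum_range_of_odd {n : ℕ} (hn : Odd n) {x : ℝ} (hx : x ≤ 0) :
    Real.exp x ≤ ∑ k ∈ Finset.range n, x ^ k / k.factorial := by
  obtain ⟨m, rfl⟩ := hn
  rcases hx.eq_or_lt with rfl | hx
  · simp [Finset.sum_range_succ']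
  have hiter {s : Set ℝ} (hs : UniqueDiffOn ℝ s) {y : ℝ} (hy : y ∈ s) (k : ℕ) :
      iteratedDerivWithin k Real.exp s y = Real.exp y := by
    rw [iteratedDerivWithin_eq_iteratedDeriv hs Real.contDiff_exp.contDiffAt hy,
      iteratedDeriv_eq_iterate, Real.iter_deriv_exp]
  obtain ⟨ξ, -, h⟩ := taylor_mean_remainder_lagrange_iteratedDeriv (n := 2 * m) hx.ne'
    Real.contDiff_exp.contDiffOn
  rw [taylor_within_apply, iteratedDeriv_eq_iterate, Real.iter_deriv_exp] at h
  simp only [hiter (uniqueDiffOn_uIcc hx.ne') left_mem_uIcc, sub_zero, Real.exp_zero, smul_eq_mul,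
    mul_one] at h
  have hrem : Real.exp ξ * x ^ (2 * m + 1) / (2 * m + 1).factorial ≤ 0 :=
    div_nonpos_of_nonpos_of_nonneg (mul_nonpos_of_nonneg_of_nonpos (Real.exp_pos ξ).le
      (Odd.pow_nonpos ⟨m, rfl⟩ hx.le)) (Nat.cast_nonneg _)
  simp only [div_eq_inv_mul]
  linarith

lemma cdf_gaussianReal_le_sum_range_of_odd {n : ℕ} (hn : Odd n) {x : ℝ} (hx : 0 ≤ x) :
    Φ x ≤ 1 / 2 + (√(2 * Real.pi))⁻¹ *
      ∑ k ∈ Finset.range n, (-1 / 2) ^ k / (k.factorial * (2 * k + 1)) * x ^ (2 * k + 1) := by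
  have hterm (u : ℝ) (k : ℕ) : HasDerivAt
      (fun u : ℝ => (-1 / 2) ^ k / (k.factorial * (2 * k + 1)) * u ^ (2 * k + 1))
      ((-u ^ 2 / 2) ^ k / k.factorial) u := by
    refine ((hasDerivAt_pow (2 * k + 1) u).const_mul _).congr_deriv ?_
    rw [Nat.add_sub_cancel, pow_mul, show -u ^ 2 / 2 = -1 / 2 * u ^ 2 by ring, mul_pow]
    push_cast
    field_simp
  have hsum (u : ℝ) := HasDerivAt.fun_sum fun k (_ : k ∈ Finset.range n) => hterm u k
  have hderiv (u : ℝ) := ((hsum u).const_mul (√(2 * Real.pi))⁻¹).sub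
    (hasDerivAt_cdf_gaussianReal (μ := 0) one_ne_zero u)
  have hmono := monotoneOn_of_hasDerivWithinAt_nonneg (convex_Ici (0 : ℝ))
    (fun u _ => (hderiv u).continuousAt.continuousWithinAt)
    (fun u _ => (hderiv u).hasDerivWithinAt) fun u _ => by
      rw [gaussianPDFReal_zero_one, ← mul_sub]
      exact mul_nonneg (by positivity) (sub_nonneg.2 (exp_le_sum_range_of_odd hn (by nlinarith)))
  have h := hmono self_mem_Ici hx hx
  simp only [Pi.sub_apply, pow_succ, mul_zero, Finset.sum_const_zero,
    cdf_gaussianReal_zero one_ne_zero] at h ⊢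
  linarith

lemma inv_sqrt_two_pi_lt : (√(2 * Real.pi))⁻¹ < 0.398944 := by
  have h : 1 / 0.398944 < √(2 * Real.pi) :=
    Real.lt_sqrt_of_sq_lt (by linarith [Real.pi_gt_d6])
  rwa [inv_lt_comm₀ (by positivity) (by norm_num), ← one_div]

lemma cdf_gaussianReal_lt_of_sum_range_lt {n : ℕ} (hn : Odd n) {x p : ℝ} (hx : 0 ≤ x)
    (h0 : 0 ≤ ∑ k ∈ Finset.range n, (-1 / 2) ^ k / (k.factorial * (2 * k + 1)) * x ^ (2 * k + 1))
    (h : 1 / 2 + 0.398944 * ∑ k ∈ Finset.range n,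
      (-1 / 2) ^ k / (k.factorial * (2 * k + 1)) * x ^ (2 * k + 1) < p) : Φ x < p :=
  (cdf_gaussianReal_le_sum_range_of_odd hn hx).trans_lt <| lt_of_le_of_lt
    (add_le_add_right (mul_le_mul_of_nonneg_right inv_sqrt_two_pi_lt.le h0) _) h

lemma cdf_gaussianReal_lt_0_9585 : Φ 1.7325 < 0.9585 := by
  refine cdf_gaussianReal_lt_of_sum_range_lt (n := 9) (by decide) (by norm_num) ?_ ?_ <;>
  norm_num [Finset.sum_range_succ, Nat.factorial]

lemma cdf_gaussianReal_lt_0_95 : Φ 1.6446 < 0.95 := by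
  refine cdf_gaussianReal_lt_of_sum_range_lt (n := 9) (by decide) (by norm_num) ?_ ?_ <;>
  norm_num [Finset.sum_range_succ, Nat.factorial]

lemma sqrt_three_le_stdNormalQuantile {α : ℝ} (h0 : 0 < α) (h1 : α ≤ 0.083) : √3 ≤ z[α] :=
  ((Real.sqrt_le_left (by norm_num)).2 (by norm_num)).trans
    (lt_stdNormalQuantile (cdf_gaussianReal_lt_0_9585.trans_le (by linarith)) (by linarith)).le

lemma lt_stdNormalQuantile_of_le_0_1 {α : ℝ} (h0 : 0 < α) (h1 : α ≤ 0.1) : 1.6446 < z[α] :=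
  lt_stdNormalQuantile (cdf_gaussianReal_lt_0_95.trans_le (by linarith)) (by linarith)

lemma hasDerivAt_gaussianPDFReal (μ : ℝ) (v : NNReal) (x : ℝ) :
    HasDerivAt (gaussianPDFReal μ v) (-((x - μ) / v) * gaussianPDFReal μ v x) x := by
  have h : HasDerivAt (fun y => -(y - μ) ^ 2 / (2 * v)) (-((x - μ) / v)) x := by
    refine ((((hasDerivAt_id x).sub_const μ).pow 2).neg.div_const (2 * v : ℝ)).congr_deriv ?_
    simp only [Nat.cast_ofNat, id_eq, Nat.add_one_sub_one, pow_one, mul_one]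
    field
  rw [gaussianPDFReal_def]
  refine (h.exp.const_mul _).congr_deriv ?_
  ring

lemma antitoneOn_mul_gaussianPDFReal :
    AntitoneOn (fun z => z * gaussianPDFReal 0 1 z) (Ici 1) := by
  have hderiv (z : ℝ) := (hasDerivAt_id z).mul (hasDerivAt_gaussianPDFReal 0 1 z)
  refine antitoneOn_of_hasDerivWithinAt_nonpos (convex_Ici 1)
    (fun z _ => (hderiv z).continuousAt.continuousWithinAt)
    (fun z _ => (hderiv z).hasDerivWithinAt) fun z hz => ?_
  rw [interior_Ici, mem_Ioi] at hz
  simp only [id, NNReal.coe_one]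
  nlinarith [mul_nonneg (show 0 ≤ z ^ 2 - 1 by nlinarith) (gaussianPDFReal_nonneg 0 1 z)]

lemma mul_gaussianPDFReal_le {z : ℝ} (hz : 1.6446 ≤ z) : z * gaussianPDFReal 0 1 z ≤ 0.17 := by
  refine (antitoneOn_mul_gaussianPDFReal (a := 1.6446) (by norm_num [mem_Ici])
    (by rw [mem_Ici]; linarith) hz).trans ?_
  have hexp : Real.exp (-1.6446 ^ 2 / 2) ≤ 0.2588 :=
    (exp_le_sum_range_of_odd (n := 9) (by decide) (by norm_num)).trans
      (by norm_num [Finset.sum_range_succ, Nat.factorial])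
  have h : gaussianPDFReal 0 1 1.6446 ≤ 0.398944 * 0.2588 := by
    rw [gaussianPDFReal_zero_one]
    exact mul_le_mul inv_sqrt_two_pi_lt.le hexp (Real.exp_pos _).le (by norm_num)
  linarith

/-- The coverage probability of the interval of half-length `z` centred at a normal estimator with
mean squared error one, bias `tanh r` and hence standard deviation `(cosh r)⁻¹`. -/
noncomputable def boundaryCoverage (z r : ℝ) : ℝ :=
  Φ (z * Real.cosh r - Real.sinh r) + Φ (z * Real.cosh r + Real.sinh r) - 1

lemma boundaryCoverage_zero (z : ℝ) : boundaryCoverage z 0 = 2 * Φ z - 1 := by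
  simp [boundaryCoverage, two_mul]

lemma boundaryCoverage_stdNormalQuantile_zero {α : ℝ} (h0 : 0 < α) (h2 : α < 2) :
    boundaryCoverage (z[α]) 0 = 1 - α := by
  rw [boundaryCoverage_zero, cdf_stdNormalQuantile (by linarith) (by linarith)]
  ring

lemma boundaryCoverage_lt_one (z r : ℝ) : boundaryCoverage z r < 1 := by
  unfold boundaryCoverage
  linarith [cdf_gaussianReal_lt_one (μ := 0) one_ne_zero (z * Real.cosh r - Real.sinh r),
    cdf_gaussianReal_lt_one (μ := 0) one_ne_zero (z * Real.cosh r + Real.sinh r)]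

/-- The factor of the derivative of `boundaryCoverage z` that determines its sign. -/
noncomputable def boundarySlope (z r : ℝ) : ℝ :=
  z * Real.sinh r * Real.cosh (z * Real.sinh r * Real.cosh r) -
    Real.cosh r * Real.sinh (z * Real.sinh r * Real.cosh r)

lemma gaussianPDFReal_mul_cosh_add (z r : ℝ) :
    gaussianPDFReal 0 1 (z * Real.cosh r + Real.sinh r) =
      gaussianPDFReal 0 1 z * Real.exp (-(z ^ 2 + 1) * Real.sinh r ^ 2 / 2) *
        Real.exp (-(z * Real.sinh r * Real.cosh r)) := by
  rw [gaussianPDFReal_zero_one, gaussianPDFReal_zero_one, mul_assoc, mul_assoc, ← Real.exp_add,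
    ← Real.exp_add]
  congr 2
  linear_combination -(z ^ 2 / 2) * Real.cosh_sq r

lemma gaussianPDFReal_mul_cosh_sub (z r : ℝ) :
    gaussianPDFReal 0 1 (z * Real.cosh r - Real.sinh r) =
      gaussianPDFReal 0 1 z * Real.exp (-(z ^ 2 + 1) * Real.sinh r ^ 2 / 2) *
        Real.exp (z * Real.sinh r * Real.cosh r) := by
  simpa [← sub_eq_add_neg] using gaussianPDFReal_mul_cosh_add z (-r)

lemma hasDerivAt_boundaryCoverage (z r : ℝ) :
    HasDerivAt (boundaryCoverage z)
      (2 * gaussianPDFReal 0 1 z * Real.exp (-(z ^ 2 + 1) * Real.sinh r ^ 2 / 2) *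
        boundarySlope z r) r := by
  have hcosh := (Real.hasDerivAt_cosh r).const_mul z
  have hsub := (hasDerivAt_cdf_gaussianReal (μ := 0) one_ne_zero _).comp r
    (hcosh.sub (Real.hasDerivAt_sinh r))
  have hadd := (hasDerivAt_cdf_gaussianReal (μ := 0) one_ne_zero _).comp r
    (hcosh.add (Real.hasDerivAt_sinh r))
  refine ((hsub.add hadd).sub_const 1).congr_deriv ?_
  simp only [Pi.sub_apply, Pi.add_apply]
  rw [gaussianPDFReal_mul_cosh_sub, gaussianPDFReal_mul_cosh_add, boundarySlope,
    Real.cosh_eq (z * _ * _), Real.sinh_eq (z * _ * _)]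
  ring

lemma strictMonoOn_boundaryCoverage {z : ℝ} {s : Set ℝ} (hs : Convex ℝ s)
    (h : ∀ r ∈ interior s, 0 < boundarySlope z r) : StrictMonoOn (boundaryCoverage z) s :=
  strictMonoOn_of_hasDerivWithinAt_pos hs
    (fun r _ => (hasDerivAt_boundaryCoverage z r).continuousAt.continuousWithinAt)
    (fun r _ => (hasDerivAt_boundaryCoverage z r).hasDerivWithinAt) fun r hr =>
      mul_pos (mul_pos (mul_pos two_pos (gaussianPDFReal_pos _ _ _ one_ne_zero))
        (Real.exp_pos _)) (h r hr)

lemma boundarySlope_pos_of_cosh_le {z r : ℝ} (h : Real.cosh r ≤ z * Real.sinh r) :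
    0 < boundarySlope z r := by
  set w := z * Real.sinh r * Real.cosh r
  calc 0 < z * Real.sinh r * (Real.cosh w - Real.sinh w) :=
        mul_pos ((Real.cosh_pos r).trans_le h) (sub_pos.2 (Real.sinh_lt_cosh w))
    _ ≤ boundarySlope z r := by
        rw [boundarySlope]
        have : 0 ≤ w := mul_nonneg ((Real.cosh_pos r).le.trans h) (Real.cosh_pos r).le
        nlinarith [Real.sinh_nonneg_iff.2 this]

lemma mul_cosh_sub_mul_sinh_ge {w x : ℝ} (hw : 0 ≤ w) (hx : x ≤ 6) :
    w * (w ^ 2 * (2 - x) / 6 + w ^ 4 * (4 - x) / 120 - x) ≤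
      w * Real.cosh w - (1 + x) * Real.sinh w := by
  have hsum := ((Real.hasSum_cosh w).mul_left w).sub ((Real.hasSum_sinh w).mul_left (1 + x))
  have hterm (k : ℕ) : w * (w ^ (2 * k) / (2 * k).factorial) -
      (1 + x) * (w ^ (2 * k + 1) / (2 * k + 1).factorial) =
      w ^ (2 * k + 1) / (2 * k + 1).factorial * (2 * k - x) := by
    rw [Nat.factorial_succ]
    push_cast
    field
  simp only [hterm] at hsum
  refine le_trans (le_of_eq ?_) (sum_le_hasSum (Finset.range 3) (fun k hk => ?_) hsum)
  · simp [Finset.sum_range_succ, Nat.factorial]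
    ring
  · have hk : (3 : ℝ) ≤ k := by exact_mod_cast not_lt.1 (Finset.mem_range.not.1 hk)
    exact mul_nonneg (by positivity) (by linarith)

/-- The polynomial that decides the sign of the truncated power series of `boundarySlope z r`,
in the variables `s = z²` and `x = sinh² r`. -/
noncomputable def slopePoly (s x : ℝ) : ℝ :=
  1 - s * (1 + x) * (2 - x) / 6 - s ^ 2 * x * (1 + x) ^ 2 * (4 - x) / 120

lemma boundarySlope_ge {z r : ℝ} (hz : 0 ≤ z) (hr : 0 ≤ r) (hx : Real.sinh r ^ 2 ≤ 6) :
    -(z * Real.sinh r * Real.sinh r ^ 2 * slopePoly (z ^ 2) (Real.sinh r ^ 2)) ≤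
      boundarySlope z r := by
  have : 0 ≤ Real.sinh r := Real.sinh_nonneg_iff.2 hr
  have hcosh := Real.cosh_pos r
  have h := mul_cosh_sub_mul_sinh_ge (w := z * Real.sinh r * Real.cosh r) (by positivity) hx
  rw [add_comm 1, ← Real.cosh_sq] at h
  refine le_of_mul_le_mul_right (le_trans (le_of_eq ?_) (h.trans_eq ?_)) hcosh
  · have e : Real.cosh r ^ 4 = (Real.sinh r ^ 2 + 1) ^ 2 := by rw [← Real.cosh_sq]; ring
    simp only [slopePoly, mul_pow, e, Real.cosh_sq]
    ring
  · rw [boundarySlope]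
    ring

lemma boundarySlope_pos_of_slopePoly_neg {z r : ℝ} (hz : 0 < z) (hr : 0 < r)
    (hx : Real.sinh r ^ 2 ≤ 6) (h : slopePoly (z ^ 2) (Real.sinh r ^ 2) < 0) :
    0 < boundarySlope z r := by
  have : 0 < Real.sinh r := Real.sinh_pos_iff.2 hr
  exact (neg_pos.2 (mul_neg_of_pos_of_neg (by positivity) h)).trans_le
    (boundarySlope_ge hz.le hr.le hx)

lemma cosh_le_mul_sinh {z r : ℝ} (hz : 0 ≤ z) (hr : 0 ≤ r)
    (h : 1 + Real.sinh r ^ 2 ≤ z ^ 2 * Real.sinh r ^ 2) : Real.cosh r ≤ z * Real.sinh r := by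
  refine le_of_sq_le_sq (a := Real.cosh r) ?_ (mul_nonneg hz (Real.sinh_nonneg_iff.2 hr))
  rw [Real.cosh_sq, mul_pow]
  linarith

lemma slopePoly_neg_of_three_le {s x : ℝ} (hs : 3 ≤ s) (hx : 0 < x) (hx1 : x < 1) :
    slopePoly s x < 0 := by
  have h2 : 0 ≤ (s - 3) * ((1 + x) * (2 - x)) :=
    mul_nonneg (by linarith) (mul_nonneg (by linarith) (by linarith))
  have h4 : 0 ≤ s ^ 2 * x * (1 + x) ^ 2 * (4 - x) := mul_nonneg (by positivity) (by linarith)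
  unfold slopePoly
  nlinarith [mul_pos hx (sub_pos.2 hx1)]

lemma boundarySlope_pos_of_three_le_sq {z r : ℝ} (hz : 0 < z) (hz3 : 3 ≤ z ^ 2) (hr : 0 < r) :
    0 < boundarySlope z r := by
  have hx : 0 < Real.sinh r ^ 2 := pow_pos (Real.sinh_pos_iff.2 hr) 2
  rcases lt_or_ge (Real.sinh r ^ 2) 1 with hx1 | hx1
  · exact boundarySlope_pos_of_slopePoly_neg hz hr (by linarith)
      (slopePoly_neg_of_three_le hz3 hx hx1)
  · exact boundarySlope_pos_of_cosh_le (cosh_le_mul_sinh hz.le hr.le (by nlinarith))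

lemma slopePoly_le {s x : ℝ} (hs : 2.7047 ≤ s) (hx : 0 ≤ x) (hx2 : x ≤ 2) :
    slopePoly s x ≤ 0.0985 - 0.6946 * x + 0.0241 * x ^ 2 := by
  have h2 : 0 ≤ (s - 2.7047) * ((1 + x) * (2 - x)) :=
    mul_nonneg (by linarith) (mul_nonneg (by linarith) (by linarith))
  have h4 : 2.7047 ^ 2 * (x * (4 + 7 * x)) ≤ s ^ 2 * (x * ((1 + x) ^ 2 * (4 - x))) := by
    gcongr
    nlinarith [mul_nonneg (pow_nonneg hx 2) (sub_nonneg.2 hx2)]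
  unfold slopePoly
  nlinarith

lemma boundarySlope_pos_of_lt_sinh_sq {z r : ℝ} (hz : 1.6446 ≤ z) (hr : 0 < r)
    (hx : 0.1426 < Real.sinh r ^ 2) : 0 < boundarySlope z r := by
  have hs : 2.7047 ≤ z ^ 2 := by nlinarith
  rcases le_or_gt (Real.sinh r ^ 2) 0.6 with hx6 | hx6
  · refine boundarySlope_pos_of_slopePoly_neg (by linarith) hr (by linarith) ?_
    refine (slopePoly_le hs (sq_nonneg _) (by linarith)).trans_lt ?_
    nlinarith
  · exact boundarySlope_pos_of_cosh_le (cosh_le_mul_sinh (by linarith) hr.le (by nlinarith))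

/-- A bound for the loss of `boundaryCoverage z r` against `boundaryCoverage z 0`, in the variable
`x = sinh² r`, for `z ≥ 1.6446`. It is the integral of `0.17` times the linear majorant of
`slopePoly` used in `slopePoly_le_linear` times `x` times a quadratic Taylor polynomial of
`exp (-1.85 x)`. -/
noncomputable def dipPoly (x : ℝ) : ℝ :=
  0.17 * 0.6908 * (0.0713 * x ^ 2 - 0.42127 * x ^ 3 + 0.5235060625 * x ^ 4 - 0.34225 * x ^ 5)

lemma hasDerivAt_dipPoly (x : ℝ) : HasDerivAt dipPoly
    (0.17 * (1 - 1.85 * x + (1.85 * x) ^ 2 / 2) * x * (0.6908 * (0.1426 - x))) x := by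
  have hpow (n : ℕ) (c : ℝ) := (hasDerivAt_pow n x).const_mul c
  refine (((((hpow 2 0.0713).sub (hpow 3 0.42127)).add (hpow 4 0.5235060625)).sub
    (hpow 5 0.34225)).const_mul (0.17 * 0.6908)).congr_deriv ?_
  push_cast
  ring

lemma exp_le_quadratic {x : ℝ} (hx : x ≤ 0) : Real.exp x ≤ 1 + x + x ^ 2 / 2 := by
  simpa [Finset.sum_range_succ] using exp_le_sum_range_of_odd (n := 3) (by decide) hx

lemma dipPoly_lt {x : ℝ} (hx : x ∈ Icc 0 0.1426) : dipPoly x < 0.00005 := by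
  have hmono : MonotoneOn dipPoly (Icc 0 0.1426) :=
    monotoneOn_of_hasDerivWithinAt_nonneg (convex_Icc _ _)
      (fun x _ => (hasDerivAt_dipPoly x).continuousAt.continuousWithinAt)
      (fun x _ => (hasDerivAt_dipPoly x).hasDerivWithinAt) fun x hx => by
        obtain ⟨hx0, hx1⟩ := interior_subset hx
        have hq : 0 ≤ 1 - 1.85 * x + (1.85 * x) ^ 2 / 2 := by nlinarith [sq_nonneg (1.85 * x - 1)]
        have : 0 ≤ 0.6908 * (0.1426 - x) := by linarith
        positivity
  refine (hmono hx (right_mem_Icc.2 (by norm_num)) hx.2).trans_lt ?_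
  norm_num [dipPoly]

lemma slopePoly_le_linear {s x : ℝ} (hs : 2.7047 ≤ s) (hx : x ∈ Icc 0 0.1426) :
    slopePoly s x ≤ 0.6908 * (0.1426 - x) := by
  refine (slopePoly_le hs hx.1 (hx.2.trans (by norm_num))).trans ?_
  nlinarith [hx.1, hx.2]

lemma deriv_boundaryCoverage_ge {z r : ℝ} (hz : 1.6446 ≤ z) (hr : 0 ≤ r)
    (hx : Real.sinh r ^ 2 ≤ 0.1426) :
    -(0.17 * (1 - 1.85 * Real.sinh r ^ 2 + (1.85 * Real.sinh r ^ 2) ^ 2 / 2) * Real.sinh r ^ 2 *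
        (0.6908 * (0.1426 - Real.sinh r ^ 2)) * (2 * Real.sinh r * Real.cosh r)) ≤
      deriv (boundaryCoverage z) r := by
  rw [(hasDerivAt_boundaryCoverage z r).deriv]
  have hsinh : 0 ≤ Real.sinh r := Real.sinh_nonneg_iff.2 hr
  have hslope := boundarySlope_ge (z := z) (by linarith) hr (by linarith)
  have hs : 2.7047 ≤ z ^ 2 := by nlinarith
  have hpoly := slopePoly_le_linear hs ⟨sq_nonneg (Real.sinh r), hx⟩
  have hcosh := Real.one_le_cosh r
  have : 0 ≤ z := by linarith
  have hpdf := mul_gaussianPDFReal_le hz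
  set φ := gaussianPDFReal 0 1 z
  have hφ : 0 ≤ φ := gaussianPDFReal_nonneg 0 1 z
  set S := Real.sinh r
  set L := 0.6908 * (0.1426 - S ^ 2)
  have : 0 ≤ L := mul_nonneg (by norm_num) (by linarith)
  have hexp : Real.exp (-(z ^ 2 + 1) * S ^ 2 / 2) ≤
      1 - 1.85 * S ^ 2 + (1.85 * S ^ 2) ^ 2 / 2 := by
    refine (Real.exp_le_exp.2 ?_).trans ((exp_le_quadratic (x := -(1.85 * S ^ 2)) ?_).trans_eq ?_)
    · linarith [mul_le_mul_of_nonneg_right hs (sq_nonneg S), sq_nonneg S]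
    · linarith [sq_nonneg S]
    · ring
  have hquad := (Real.exp_pos _).le.trans hexp
  rw [neg_le, ← mul_neg]
  calc 2 * φ * Real.exp (-(z ^ 2 + 1) * S ^ 2 / 2) * -boundarySlope z r
      ≤ 2 * φ * Real.exp (-(z ^ 2 + 1) * S ^ 2 / 2) * (z * S * S ^ 2 * L) := by
        gcongr
        exact (neg_le.1 hslope).trans (by gcongr)
    _ = z * φ * Real.exp (-(z ^ 2 + 1) * S ^ 2 / 2) * S ^ 2 * L * (2 * S * 1) := by ring
    _ ≤ _ := by gcongr

lemma boundaryCoverage_ge_sub_dipPoly {z r : ℝ} (hz : 1.6446 ≤ z) (hr : 0 ≤ r)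
    (hx : Real.sinh r ^ 2 ≤ 0.1426) :
    boundaryCoverage z 0 - dipPoly (Real.sinh r ^ 2) ≤ boundaryCoverage z r := by
  have hderiv (t : ℝ) := (hasDerivAt_boundaryCoverage z t).differentiableAt.hasDerivAt.add
    ((hasDerivAt_dipPoly _).comp t ((Real.hasDerivAt_sinh t).pow 2))
  have hmono := monotoneOn_of_hasDerivWithinAt_nonneg (convex_Icc 0 r)
    (fun t _ => (hderiv t).continuousAt.continuousWithinAt)
    (fun t _ => (hderiv t).hasDerivWithinAt) fun t ht => by
      obtain ⟨ht0, htr⟩ := interior_subset ht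
      have hsinh : Real.sinh t ^ 2 ≤ Real.sinh r ^ 2 :=
        pow_le_pow_left₀ (Real.sinh_nonneg_iff.2 ht0) (Real.sinh_le_sinh.2 htr) 2
      have h := deriv_boundaryCoverage_ge hz ht0 (hsinh.trans hx)
      simp only [Nat.cast_ofNat, Pi.pow_apply, pow_one, Nat.add_one_sub_one]
      linarith
  have h := hmono (left_mem_Icc.2 hr) (right_mem_Icc.2 hr) hr
  have h0 : dipPoly 0 = 0 := by simp [dipPoly]
  simp only [Pi.add_apply, Function.comp_apply, Pi.pow_apply, Real.sinh_zero, ne_eq,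
    OfNat.ofNat_ne_zero, not_false_eq_true, zero_pow, h0, add_zero] at h
  linarith

lemma boundaryCoverage_gt {z r : ℝ} (hz : 1.6446 ≤ z) (hr : 0 ≤ r) :
    boundaryCoverage z 0 - 0.00005 < boundaryCoverage z r := by
  have hdip {t : ℝ} (ht : 0 ≤ t) (hx : Real.sinh t ^ 2 ≤ 0.1426) :
      boundaryCoverage z 0 - 0.00005 < boundaryCoverage z t := by
    linarith [boundaryCoverage_ge_sub_dipPoly hz ht hx, dipPoly_lt ⟨sq_nonneg _, hx⟩]
  rcases le_or_gt (Real.sinh r ^ 2) 0.1426 with hx | hx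
  · exact hdip hr hx
  set t := Real.arsinh √0.1426
  have ht0 : 0 ≤ t := Real.arsinh_nonneg_iff.2 (Real.sqrt_nonneg _)
  have ht : Real.sinh t ^ 2 = 0.1426 := by
    rw [Real.sinh_arsinh, Real.sq_sqrt (by norm_num)]
  have htr : t ≤ r := by
    rw [← Real.sinh_le_sinh]
    exact le_of_sq_le_sq (by linarith) (Real.sinh_nonneg_iff.2 hr)
  have hmono : StrictMonoOn (boundaryCoverage z) (Ici t) :=
    strictMonoOn_boundaryCoverage (convex_Ici t) fun u hu => by
      rw [interior_Ici, mem_Ioi] at hu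
      refine boundarySlope_pos_of_lt_sinh_sq hz (ht0.trans_lt hu) (ht ▸ ?_)
      exact pow_lt_pow_left₀ (Real.sinh_lt_sinh.2 hu) (Real.sinh_nonneg_iff.2 ht0) two_ne_zero
  exact (hdip ht0 ht.le).trans_le (hmono.monotoneOn self_mem_Ici htr htr)

lemma boundaryCoverage_artanh_div {z b s σ : ℝ} (hs : 0 < s) (hσ : 0 < σ)
    (h : b ^ 2 + σ ^ 2 = s ^ 2) :
    boundaryCoverage z (Real.artanh (b / s)) =
      Φ ((z * s - b) / σ) + Φ ((z * s + b) / σ) - 1 := by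
  have hsq : 1 - (b / s) ^ 2 = (σ / s) ^ 2 := by
    field_simp
    linarith
  have hsqrt : √(1 - (b / s) ^ 2) = σ / s := by rw [hsq, Real.sqrt_sq (by positivity)]
  have hmem : b / s ∈ Ioo (-1) 1 := by
    rw [mem_Ioo, ← abs_lt, ← sq_lt_one_iff_abs_lt_one]
    nlinarith [pow_pos (div_pos hσ hs) 2]
  rw [boundaryCoverage, Real.sinh_artanh hmem, Real.cosh_artanh hmem, hsqrt]
  congr 3 <;> field

lemma strictMonoOn_boundaryCoverage_of_sqrt_three_le {z : ℝ} (hz : √3 ≤ z) :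
    StrictMonoOn (boundaryCoverage z) (Ici 0) :=
  strictMonoOn_boundaryCoverage (convex_Ici 0) fun r hr => by
    rw [interior_Ici, mem_Ioi] at hr
    exact boundarySlope_pos_of_three_le_sq ((Real.sqrt_pos.2 three_pos).trans_le hz)
      ((Real.sqrt_le_left ((Real.sqrt_nonneg 3).trans hz)).1 hz) hr

lemma strictMonoOn_boundaryCoverage_of_one_le_mul_tanh {z a : ℝ} (hz : 0 ≤ z)
    (ha : 1 ≤ z * Real.tanh a) : StrictMonoOn (boundaryCoverage z) (Ici a) :=
  strictMonoOn_boundaryCoverage (convex_Ici a) fun r hr => by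
    rw [interior_Ici, mem_Ioi] at hr
    have htanh : Real.tanh a < Real.tanh r := by
      rwa [← Real.artanh_lt_artanh_iff ⟨Real.neg_one_lt_tanh a, Real.tanh_lt_one a⟩
        ⟨Real.neg_one_lt_tanh r, Real.tanh_lt_one r⟩, Real.artanh_tanh, Real.artanh_tanh]
    have h := ha.trans (mul_le_mul_of_nonneg_left htanh.le hz)
    rw [Real.tanh_eq_sinh_div_cosh, ← mul_div_assoc, one_le_div (Real.cosh_pos r)] at h
    exact boundarySlope_pos_of_cosh_le h

section Coverage

variable {Ω : Type*} [MeasurableSpace Ω] {P : Measure Ω} {est : Ω → ℝ} {s α θ : ℝ}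

lemma MSE_eq_variance_add_sq [IsProbabilityMeasure P] (h : MemLp est 2 P) (θ : ℝ) :
    MSE P est θ = Var[est; P] + (P[est] - θ) ^ 2 := by
  have hmean : ∫ ω, (est ω - θ) ∂P = P[est] - θ := by
    rw [integral_sub (h.integrable one_le_two) (integrable_const θ), integral_const, probReal_univ,
      one_smul]
  have hvar := variance_eq_sub (h.sub (memLp_const θ))
  rw [← variance_sub_const h.aestronglyMeasurable θ, ← hmean]
  exact eq_add_of_sub_eq hvar.symm

lemma MSE_eq_of_hasLaw_gaussianReal {b σ : ℝ} [IsProbabilityMeasure P]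
    (h : HasLaw est (gaussianReal (θ + b) (Real.toNNReal (σ ^ 2))) P) :
    MSE P est θ = b ^ 2 + σ ^ 2 := by
  rw [MSE_eq_variance_add_sq h.hasGaussianLaw.memLp_two, h.integral_eq, h.variance_eq,
    integral_id_gaussianReal, variance_id_gaussianReal, Real.coe_toNNReal _ (sq_nonneg σ)]
  ring

lemma one_sub_variance_div_sq_le_coverageProb [IsProbabilityMeasure P] (h : MemLp est 2 P)
    (hbias : |P[est] - θ| < z[α] * s) :
    1 - Var[est; P] / (z[α] * s - |P[est] - θ|) ^ 2 ≤
      coverageProb P (normalCI est s α) θ := by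
  set c := z[α] * s - |P[est] - θ|
  have hcheb : P.real {ω | c ≤ |est ω - P[est]|} ≤ Var[est; P] / c ^ 2 :=
    ENNReal.toReal_le_of_le_ofReal (div_nonneg (variance_nonneg _ _) (sq_nonneg _))
      (meas_ge_le_variance_div_sq h (sub_pos.2 hbias))
  have hcover : univ ⊆ {ω | θ ∈ normalCI est s α ω} ∪ {ω | c ≤ |est ω - P[est]|} := by
    intro ω _
    refine or_iff_not_imp_right.2 fun hω => ?_
    have hdev : |est ω - P[est]| < c := not_le.1 hω
    have htri := abs_sub_le (est ω) P[est] θ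
    have hdist : |est ω - θ| ≤ z[α] * s := by linarith
    obtain ⟨hlow, hupp⟩ := abs_le.1 hdist
    exact ⟨by linarith, by linarith⟩
  have hunion := (measureReal_mono hcover).trans (measureReal_union_le (μ := P) _ _)
  rw [probReal_univ] at hunion
  unfold coverageProb
  linarith

lemma coverageProb_normalCI {b σ : ℝ} (hσ : 0 < σ) (hq : 0 ≤ z[α] * s)
    (h : HasLaw est (gaussianReal (θ + b) (Real.toNNReal (σ ^ 2))) P) :
    coverageProb P (normalCI est s α) θ =
      Φ ((z[α] * s - b) / σ) +
        Φ ((z[α] * s + b) / σ) - 1 := by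
  set c := z[α] * s with hc
  have := nullSingletonClass_gaussianReal (μ := 0) (v := 1) one_ne_zero
  have hstd : HasLaw (fun ω => (est ω - (θ + b)) / σ) (gaussianReal 0 1) P := by
    have hv : Real.toNNReal (σ ^ 2) / NNReal.mk (σ ^ 2) (sq_nonneg σ) = 1 := by
      rw [Real.toNNReal_of_nonneg (sq_nonneg σ)]
      exact div_self (ne_of_gt (pow_pos hσ 2))
    simpa [hv] using gaussianReal_div_const (gaussianReal_sub_const h (θ + b)) σ
  have hset : {ω | θ ∈ normalCI est s α ω} =
      {ω | (est ω - (θ + b)) / σ ∈ Icc (-((c + b) / σ)) ((c - b) / σ)} := by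
    ext ω
    simp only [normalCI, mem_ofPred_eq, mem_Icc, ← hc]
    rw [← neg_div, div_le_div_iff_of_pos_right hσ, div_le_div_iff_of_pos_right hσ]
    constructor <;> rintro ⟨_, _⟩ <;> constructor <;> linarith
  have hle : -((c + b) / σ) ≤ (c - b) / σ := by
    rw [← neg_div, div_le_div_iff_of_pos_right hσ]
    linarith
  rw [coverageProb, hset, hstd.measureReal_eq (p := (· ∈ Icc _ _)) measurableSet_Icc,
    ofPred_mem_eq, measureReal_Icc_eq_cdf_sub hle, cdf_gaussianReal_neg one_ne_zero]
  ring

lemma coverageProb_normalCI_of_unbiased (hs : 0 < s) (h0 : 0 < α) (h1 : α < 1)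
    (h : HasLaw est (gaussianReal θ (Real.toNNReal (s ^ 2))) P) :
    coverageProb P (normalCI est s α) θ = 1 - α := by
  have hq : 0 < z[α] :=
    lt_stdNormalQuantile (by rw [cdf_gaussianReal_zero one_ne_zero]; linarith) (by linarith)
  rw [coverageProb_normalCI (b := 0) hs (by positivity) (by simpa using h), sub_zero, add_zero,
    mul_div_cancel_right₀ _ hs.ne', cdf_stdNormalQuantile (by linarith) (by linarith)]
  ring

end Coverage

namespace NormalEstimators

variable {Ω : Type*} [MeasurableSpace Ω] {P : Measure Ω} {est₁ est₂ : Ω → ℝ}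
  {θ b₂ s₁ s₂ α : ℝ}

lemma abs_bias_div_mem_Ioo (h : NormalEstimators P est₁ est₂ θ b₂ s₁ s₂) (hb : |b₂| < s₁) :
    |b₂| / s₁ ∈ Ioo (-1) 1 :=
  ⟨neg_one_lt_zero.trans_le (div_nonneg (abs_nonneg _) h.s₁_pos.le), (div_lt_one h.s₁_pos).2 hb⟩

lemma coverageProb_snd (h : NormalEstimators P est₁ est₂ θ b₂ s₁ s₂) (hs₂ : 0 < s₂)
    (hq : 0 ≤ z[α]) :
    coverageProb P (normalCI est₂ s₁ α) θ =
      Φ ((z[α] * s₁ - |b₂|) / s₂) + Φ ((z[α] * s₁ + |b₂|) / s₂) - 1 := by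
  rw [coverageProb_normalCI hs₂ (mul_nonneg hq h.s₁_pos.le) h.law₂]
  rcases abs_choice b₂ with hb | hb
  · rw [hb]
  · rw [hb, sub_neg_eq_add, ← sub_eq_add_neg, add_comm (Φ _)]

variable [IsProbabilityMeasure P]

lemma MSE_fst (h : NormalEstimators P est₁ est₂ θ b₂ s₁ s₂) : MSE P est₁ θ = s₁ ^ 2 := by
  simpa using MSE_eq_of_hasLaw_gaussianReal (b := 0) ((add_zero θ).symm ▸ h.law₁)

lemma MSE_snd (h : NormalEstimators P est₁ est₂ θ b₂ s₁ s₂) : MSE P est₂ θ = b₂ ^ 2 + s₂ ^ 2 :=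
  MSE_eq_of_hasLaw_gaussianReal h.law₂

lemma MSE_le_iff (h : NormalEstimators P est₁ est₂ θ b₂ s₁ s₂) :
    MSE P est₂ θ ≤ MSE P est₁ θ ↔ b₂ ^ 2 + s₂ ^ 2 ≤ s₁ ^ 2 := by
  rw [h.MSE_fst, h.MSE_snd]

lemma abs_bias_le (h : NormalEstimators P est₁ est₂ θ b₂ s₁ s₂)
    (hM : MSE P est₂ θ ≤ MSE P est₁ θ) : |b₂| ≤ s₁ :=
  abs_le_of_sq_le_sq (by nlinarith [h.MSE_le_iff.1 hM]) h.s₁_pos.le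

lemma one_sub_sq_div_le_coverageProb_snd (h : NormalEstimators P est₁ est₂ θ b₂ s₁ s₂)
    (hb : |b₂| < z[α] * s₁) :
    1 - (s₂ / (z[α] * s₁ - |b₂|)) ^ 2 ≤ coverageProb P (normalCI est₂ s₁ α) θ := by
  have hbias : P[est₂] - θ = b₂ := by
    rw [h.law₂.integral_eq, integral_id_gaussianReal, add_sub_cancel_left]
  have hvar : Var[est₂; P] = s₂ ^ 2 := by
    rw [h.law₂.variance_eq, variance_id_gaussianReal, Real.coe_toNNReal _ (sq_nonneg s₂)]
  have hcheb := one_sub_variance_div_sq_le_coverageProb h.law₂.hasGaussianLaw.memLp_two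
    (hbias.symm ▸ hb)
  rwa [hvar, hbias, ← div_pow] at hcheb

lemma one_le_coverageProb_snd (h : NormalEstimators P est₁ est₂ θ b₂ s₁ 0)
    (hb : |b₂| < z[α] * s₁) : 1 ≤ coverageProb P (normalCI est₂ s₁ α) θ := by
  simpa using h.one_sub_sq_div_le_coverageProb_snd hb

lemma coverageProb_snd_eq_boundaryCoverage (h : NormalEstimators P est₁ est₂ θ b₂ s₁ s₂)
    (hM : MSE P est₂ θ = MSE P est₁ θ) (hb : |b₂| < s₁) (hq : 0 ≤ z[α]) :
    coverageProb P (normalCI est₂ s₁ α) θ = boundaryCoverage z[α] (Real.artanh (|b₂| / s₁)) := by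
  rw [h.MSE_fst, h.MSE_snd, ← sq_abs b₂] at hM
  have hs₂ : 0 < s₂ := h.s₂_nonneg.lt_of_ne fun hs => by
    nlinarith [abs_nonneg b₂, h.s₁_pos]
  rw [h.coverageProb_snd hs₂ hq, boundaryCoverage_artanh_div h.s₁_pos hs₂ hM]

lemma boundaryCoverage_le_coverageProb_snd (h : NormalEstimators P est₁ est₂ θ b₂ s₁ s₂)
    (hM : MSE P est₂ θ ≤ MSE P est₁ θ) (hb : |b₂| < s₁) (hq : 1 ≤ z[α]) :
    boundaryCoverage z[α] (Real.artanh (|b₂| / s₁)) ≤ coverageProb P (normalCI est₂ s₁ α) θ := by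
  have hs₁ := h.s₁_pos
  have hbq : |b₂| < z[α] * s₁ := hb.trans_le (le_mul_of_one_le_left hs₁.le hq)
  rcases h.s₂_nonneg.eq_or_lt with rfl | hs₂
  · exact (boundaryCoverage_lt_one _ _).le.trans (h.one_le_coverageProb_snd hbq)
  rw [h.MSE_le_iff, ← sq_abs b₂] at hM
  have hσsq : 0 < s₁ ^ 2 - |b₂| ^ 2 := by nlinarith
  have hσ : |b₂| ^ 2 + √(s₁ ^ 2 - |b₂| ^ 2) ^ 2 = s₁ ^ 2 := by
    rw [Real.sq_sqrt hσsq.le, add_sub_cancel]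
  have hs₂σ : s₂ ≤ √(s₁ ^ 2 - |b₂| ^ 2) := Real.le_sqrt_of_sq_le (by linarith)
  have : Monotone Φ := (strictMono_cdf_gaussianReal one_ne_zero).monotone
  rw [h.coverageProb_snd hs₂ (by linarith),
    boundaryCoverage_artanh_div hs₁ (Real.sqrt_pos.2 hσsq) hσ]
  gcongr

lemma lt_coverageProb_snd (h : NormalEstimators P est₁ est₂ θ b₂ s₁ s₂)
    (hM : MSE P est₂ θ ≤ MSE P est₁ θ) (hq : 1 < z[α]) {c : ℝ} (hc1 : c < 1)
    (hc : |b₂| < s₁ → c < boundaryCoverage z[α] (Real.artanh (|b₂| / s₁))) :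
    c < coverageProb P (normalCI est₂ s₁ α) θ := by
  rcases (h.abs_bias_le hM).lt_or_eq with hb | hb
  · exact (hc hb).trans_le (h.boundaryCoverage_le_coverageProb_snd hM hb hq.le)
  · have hs₂ : s₂ = 0 := by
      rw [h.MSE_le_iff, ← sq_abs b₂, hb] at hM
      exact pow_eq_zero_iff two_ne_zero |>.1 (by linarith [sq_nonneg s₂])
    subst hs₂
    exact hc1.trans_le (h.one_le_coverageProb_snd (hb.trans_lt (lt_mul_of_one_lt_left h.s₁_pos hq)))

lemma one_sub_lt_coverageProb_snd (h : NormalEstimators P est₁ est₂ θ b₂ s₁ s₂)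
    (hM : MSE P est₂ θ ≤ MSE P est₁ θ) (h0 : 0 < α) (h1 : α < 1) (hq : √3 ≤ z[α]) (hb : b₂ ≠ 0) :
    1 - α < coverageProb P (normalCI est₂ s₁ α) θ := by
  have hq1 : 1 < z[α] := (Real.lt_sqrt_of_sq_lt (by norm_num)).trans_le hq
  refine h.lt_coverageProb_snd hM hq1 (by linarith) fun hbs => ?_
  have hr : 0 < Real.artanh (|b₂| / s₁) :=
    Real.artanh_pos ⟨div_pos (abs_pos.2 hb) h.s₁_pos, (div_lt_one h.s₁_pos).2 hbs⟩
  calc 1 - α = boundaryCoverage z[α] 0 := by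
        rw [boundaryCoverage_stdNormalQuantile_zero h0 (by linarith)]
    _ < boundaryCoverage z[α] (Real.artanh (|b₂| / s₁)) :=
        strictMonoOn_boundaryCoverage_of_sqrt_three_le hq self_mem_Ici hr.le hr

lemma one_sub_sub_lt_coverageProb_snd (h : NormalEstimators P est₁ est₂ θ b₂ s₁ s₂)
    (hM : MSE P est₂ θ ≤ MSE P est₁ θ) (h0 : 0 < α) (h1 : α ≤ 0.1) :
    1 - α - 0.00005 < coverageProb P (normalCI est₂ s₁ α) θ := by
  have hq := lt_stdNormalQuantile_of_le_0_1 h0 h1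
  refine h.lt_coverageProb_snd hM (by linarith) (by linarith) fun _ => ?_
  have hr : 0 ≤ Real.artanh (|b₂| / s₁) :=
    Real.artanh_nonneg (div_nonneg (abs_nonneg _) h.s₁_pos.le)
  calc 1 - α - 0.00005 = boundaryCoverage z[α] 0 - 0.00005 := by
        rw [boundaryCoverage_stdNormalQuantile_zero h0 (by linarith)]
    _ < boundaryCoverage z[α] (Real.artanh (|b₂| / s₁)) := boundaryCoverage_gt hq.le hr

lemma one_sub_lt_coverageProb_snd_of_lt_abs_bias (h : NormalEstimators P est₁ est₂ θ b₂ s₁ s₂)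
    (hM : MSE P est₂ θ ≤ MSE P est₁ θ) (hq : 1 < z[α]) {ε : ℝ}
    (hb : s₁ - ε * (z[α] - 1) ^ 2 * s₁ / 2 < |b₂|) :
    1 - ε < coverageProb P (normalCI est₂ s₁ α) θ := by
  have hs₁ := h.s₁_pos
  have hbs := h.abs_bias_le hM
  have hc : 0 < (z[α] - 1) * s₁ := mul_pos (sub_pos.2 hq) hs₁
  have hcb : (z[α] - 1) * s₁ ≤ z[α] * s₁ - |b₂| := by linarith
  rw [h.MSE_le_iff, ← sq_abs b₂] at hM
  have hs₂ : s₂ ^ 2 < ε * ((z[α] - 1) * s₁) ^ 2 := by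
    nlinarith [abs_nonneg b₂]
  have hε : 0 < ε :=
    (mul_pos_iff_of_pos_right (pow_pos hc 2)).1 ((sq_nonneg s₂).trans_lt hs₂)
  have hsub : 0 < z[α] * s₁ - |b₂| := hc.trans_le hcb
  have hsq : (s₂ / (z[α] * s₁ - |b₂|)) ^ 2 < ε := by
    rw [div_pow, div_lt_iff₀ (by positivity)]
    exact hs₂.trans_le (by gcongr)
  linarith [h.one_sub_sq_div_le_coverageProb_snd (α := α) (sub_pos.1 hsub)]

lemma coverageProb_snd_lt_coverageProb_snd {Ω' : Type*} [MeasurableSpace Ω'] {P' : Measure Ω'}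
    [IsProbabilityMeasure P'] {est₁' est₂' : Ω' → ℝ} {θ' b₂' s₂' : ℝ}
    (h : NormalEstimators P est₁ est₂ θ b₂ s₁ s₂) (hM : MSE P est₂ θ = MSE P est₁ θ)
    (h' : NormalEstimators P' est₁' est₂' θ' b₂' s₁ s₂') (hM' : MSE P' est₂' θ' ≤ MSE P' est₁' θ')
    (hq : 1 < z[α]) (hb : s₁ / z[α] ≤ |b₂|) (hbb' : |b₂| < |b₂'|) :
    coverageProb P (normalCI est₂ s₁ α) θ < coverageProb P' (normalCI est₂' s₁ α) θ' := by
  have hs₁ := h.s₁_pos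
  have hbs : |b₂| < s₁ := hbb'.trans_le (h'.abs_bias_le hM')
  have hmem := h.abs_bias_div_mem_Ioo hbs
  rw [h.coverageProb_snd_eq_boundaryCoverage hM hbs (by linarith)]
  refine h'.lt_coverageProb_snd hM' hq (boundaryCoverage_lt_one _ _) fun hbs' => ?_
  have hr : Real.artanh (|b₂| / s₁) < Real.artanh (|b₂'| / s₁) :=
    Real.artanh_lt_artanh hmem.1 (h'.abs_bias_div_mem_Ioo hbs').2 (by gcongr)
  refine strictMonoOn_boundaryCoverage_of_one_le_mul_tanh (by linarith) ?_ self_mem_Ici hr.le hr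
  rw [Real.tanh_artanh hmem, ← mul_div_assoc, one_le_div hs₁]
  exact (div_le_iff₀' (by linarith)).1 hb

end NormalEstimators

theorem corollary1_general :
    (∀ {Ω : Type*} [MeasurableSpace Ω] (P : Measure Ω) (est₁ : Ω → ℝ) (θ s₁ α : ℝ),
      0 < s₁ → HasLaw est₁ (gaussianReal θ (Real.toNNReal (s₁ ^ 2))) P → 0 < α → α < 1 →
      coverageProb P (normalCI est₁ s₁ α) θ = 1 - α) ∧
    (∀ {Ω : Type*} [MeasurableSpace Ω] (P : Measure Ω) [IsProbabilityMeasure P]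
      (est₁ est₂ : Ω → ℝ) (θ b₂ s₁ s₂ α : ℝ),
      NormalEstimators P est₁ est₂ θ b₂ s₁ s₂ → MSE P est₂ θ ≤ MSE P est₁ θ →
      0 < α → α < 1 → √3 ≤ z[α] → b₂ ≠ 0 →
      1 - α < coverageProb P (normalCI est₂ s₁ α) θ) ∧
    (∀ {Ω : Type*} [MeasurableSpace Ω] (P : Measure Ω) [IsProbabilityMeasure P]
      (est₁ est₂ : Ω → ℝ) (θ b₂ s₁ s₂ α : ℝ),
      NormalEstimators P est₁ est₂ θ b₂ s₁ s₂ → MSE P est₂ θ ≤ MSE P est₁ θ →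
      0 < α → α ≤ 0.1 →
      1 - α - 0.00005 < coverageProb P (normalCI est₂ s₁ α) θ) ∧
    (∀ α : ℝ, 1 < z[α] → ∀ s₁ : ℝ, 0 < s₁ → ∀ ε : ℝ, 0 < ε → ∃ δ : ℝ, 0 < δ ∧
      ∀ {Ω : Type*} [MeasurableSpace Ω] (P : Measure Ω) [IsProbabilityMeasure P]
        (est₁ est₂ : Ω → ℝ) (θ b₂ s₂ : ℝ),
        NormalEstimators P est₁ est₂ θ b₂ s₁ s₂ → MSE P est₂ θ ≤ MSE P est₁ θ →
        s₁ - δ < |b₂| →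
        1 - ε < coverageProb P (normalCI est₂ s₁ α) θ) ∧
    (∀ α : ℝ, 1 < z[α] → ∀ s₁ : ℝ, 0 < s₁ → ∃ b₀ : ℝ, b₀ < s₁ ∧
      ∀ {Ω Ω' : Type*} [MeasurableSpace Ω] [MeasurableSpace Ω']
        (P : Measure Ω) [IsProbabilityMeasure P] (P' : Measure Ω') [IsProbabilityMeasure P']
        (est₁ est₂ : Ω → ℝ) (est₁' est₂' : Ω' → ℝ) (θ θ' b₂ b₂' s₂ s₂' : ℝ),
        NormalEstimators P est₁ est₂ θ b₂ s₁ s₂ → MSE P est₂ θ = MSE P est₁ θ →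
        NormalEstimators P' est₁' est₂' θ' b₂' s₁ s₂' → MSE P' est₂' θ' ≤ MSE P' est₁' θ' →
        b₀ ≤ |b₂| → |b₂| < |b₂'| →
        coverageProb P (normalCI est₂ s₁ α) θ < coverageProb P' (normalCI est₂' s₁ α) θ') := by
  refine ⟨?exact_coverage, ?high_level, ?rounding, ?limit, ?increase⟩
  case exact_coverage =>
    intro Ω _ P est₁ θ s₁ α hs₁ hlaw h0 h1
    exact coverageProb_normalCI_of_unbiased hs₁ h0 h1 hlaw
  case high_level =>
    intro Ω _ P _ est₁ est₂ θ b₂ s₁ s₂ α h hM h0 h1 hz hb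
    exact h.one_sub_lt_coverageProb_snd hM h0 h1 hz hb
  case rounding =>
    intro Ω _ P _ est₁ est₂ θ b₂ s₁ s₂ α h hM h0 h1
    exact h.one_sub_sub_lt_coverageProb_snd hM h0 h1
  case limit =>
    intro α hz s₁ hs₁ ε hε
    have : 0 < z[α] - 1 := sub_pos.2 hz
    refine ⟨ε * (z[α] - 1) ^ 2 * s₁ / 2, by positivity, ?_⟩
    intro Ω _ P _ est₁ est₂ θ b₂ s₂ h hM hb
    exact h.one_sub_lt_coverageProb_snd_of_lt_abs_bias hM hz hb
  case increase =>
    intro α hz s₁ hs₁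
    refine ⟨s₁ / z[α], div_lt_self hs₁ hz, ?_⟩
    intro Ω Ω' _ _ P _ P' _ est₁ est₂ est₁' est₂' θ θ' b₂ b₂' s₂ s₂' h hM h' hM' hb hbb'
    exact h.coverageProb_snd_lt_coverageProb_snd hM h' hM' hz hb hbb'

theorem corollary1 :
    -- the benchmark interval centered at `est₁` has exact coverage
    (∀ {Ω : Type*} [MeasurableSpace Ω] (P : Measure Ω) [IsProbabilityMeasure P]
      (est₁ est₂ : Ω → ℝ) (θ b₂ s₁ s₂ α : ℝ),
      NormalEstimators P est₁ est₂ θ b₂ s₁ s₂ → MSE P est₂ θ ≤ MSE P est₁ θ →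
      0 < α → α < 1 →
      coverageProb P (normalCI est₁ s₁ α) θ = 1 - α) ∧
    -- confidence levels of at least 91.7%
    (∀ {Ω : Type*} [MeasurableSpace Ω] (P : Measure Ω) [IsProbabilityMeasure P]
      (est₁ est₂ : Ω → ℝ) (θ b₂ s₁ s₂ α : ℝ),
      NormalEstimators P est₁ est₂ θ b₂ s₁ s₂ → MSE P est₂ θ ≤ MSE P est₁ θ →
      0 < α → 0.917 ≤ 1 - α → b₂ ≠ 0 →
      1 - α < coverageProb P (normalCI est₂ s₁ α) θ) ∧
    -- confidence level 90%: coverage of at least 90.00% after rounding to two decimals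
    (∀ {Ω : Type*} [MeasurableSpace Ω] (P : Measure Ω) [IsProbabilityMeasure P]
      (est₁ est₂ : Ω → ℝ) (θ b₂ s₁ s₂ : ℝ),
      NormalEstimators P est₁ est₂ θ b₂ s₁ s₂ → MSE P est₂ θ ≤ MSE P est₁ θ →
      0.89995 ≤ coverageProb P (normalCI est₂ s₁ 0.1) θ) ∧
    -- confidence level 90%: coverage tends to 100% as `|b₂| → s₁`, uniformly in everything else
    (∀ s₁ : ℝ, 0 < s₁ → ∀ ε : ℝ, 0 < ε → ∃ δ : ℝ, 0 < δ ∧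
      ∀ {Ω : Type*} [MeasurableSpace Ω] (P : Measure Ω) [IsProbabilityMeasure P]
        (est₁ est₂ : Ω → ℝ) (θ b₂ s₂ : ℝ),
        NormalEstimators P est₁ est₂ θ b₂ s₁ s₂ → MSE P est₂ θ ≤ MSE P est₁ θ →
        s₁ - δ < |b₂| →
        1 - ε < coverageProb P (normalCI est₂ s₁ 0.1) θ) ∧
    -- confidence level 90%: once `|b₂|` is close to `s₁`, the coverage increases along the equal-MSE
    -- boundary, and the boundary value is exceeded by every admissible one of larger bias
    (∀ s₁ : ℝ, 0 < s₁ → ∃ b₀ : ℝ, b₀ < s₁ ∧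
      ∀ {Ω Ω' : Type*} [MeasurableSpace Ω] [MeasurableSpace Ω']
        (P : Measure Ω) [IsProbabilityMeasure P] (P' : Measure Ω') [IsProbabilityMeasure P']
        (est₁ est₂ : Ω → ℝ) (est₁' est₂' : Ω' → ℝ) (θ θ' b₂ b₂' s₂ s₂' : ℝ),
        NormalEstimators P est₁ est₂ θ b₂ s₁ s₂ → MSE P est₂ θ = MSE P est₁ θ →
        NormalEstimators P' est₁' est₂' θ' b₂' s₁ s₂' → MSE P' est₂' θ' ≤ MSE P' est₁' θ' →
        b₀ ≤ |b₂| → |b₂| < |b₂'| →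
        coverageProb P (normalCI est₂ s₁ 0.1) θ < coverageProb P' (normalCI est₂' s₁ 0.1) θ') := by
  obtain ⟨hexact, hhigh, hround, hlimit, hincrease⟩ := corollary1_general
  have hz : 1 < z[(0.1 : ℝ)] :=
    lt_trans (by norm_num) (lt_stdNormalQuantile_of_le_0_1 (by norm_num) le_rfl)
  refine ⟨?_, ?_, ?_, hlimit 0.1 hz, hincrease 0.1 hz⟩
  · intro Ω _ P _ est₁ est₂ θ b₂ s₁ s₂ α h _ h0 h1
    exact hexact P est₁ θ s₁ α h.s₁_pos h.law₁ h0 h1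
  · intro Ω _ P _ est₁ est₂ θ b₂ s₁ s₂ α h hM h0 h1 hb
    exact hhigh P est₁ est₂ θ b₂ s₁ s₂ α h hM h0 (by linarith)
      (sqrt_three_le_stdNormalQuantile h0 (by linarith)) hb
  · intro Ω _ P _ est₁ est₂ θ b₂ s₁ s₂ h hM
    linarith [hround P est₁ est₂ θ b₂ s₁ s₂ 0.1 h hM (by norm_num) le_rfl]
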